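/- Let $d\ge 1$ be an integer and let $\lambda_1,\dots,\lambda_d$ be independent random variables, each uniformly distributed on $[-1,1]$. Let $H=\sum_{k=1}^d\lambda_k|k\rangle\langle k|$ be the corresponding random diagonal Hamiltonian on $\mathbb{C}^d$, let $|\psi_0\rangle=\frac{1}{\sqrt d}\sum_{k=1}^d|k\rangle$, and let $\psi_t=e^{-iHt}|\psi_0\rangle\langle\psi_0|e^{iHt}$. With the trace distance $D_{\mathrm{tr}}(\rho,\sigma)=\frac12\|\rho-\sigma\|_1$, define the exit time and the recurrence time by $$t_{\mathrm{exit}}(\varepsilon)=\inf\{t>0 : D_{\mathrm{tr}}(\psi_0,\psi_t)\ge\varepsilon\},\qquad t_{\mathrm{rec}}(\varepsilon)=\inf\{t>t_{\mathrm{exit}}(\varepsilon) : D_{\mathrm{tr}}(\psi_0,\psi_t)\le\varepsilon\},$$ with values in $[0,+\infty]$ and $\inf\emptyset=+\infty$. Assume that $(40\pi)^{1/3}\,2^{-d/3}<\varepsilon<\frac{1}{10000}$. Then, with probability at least $1-\left(\frac34\right)^d-5e^{-d/400}$ over the choice of $\lambda_1,\dots,\lambda_d$, $$t_{\mathrm{rec}}(\varepsilon)>20\left(\frac{1}{10000}\cdot\frac{1}{\varepsilon}\right)^d.$$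 -/

import Mathlib

namespace QRec

noncomputable section

/-- The exit time `inf {t > 0 | D (x 0) (x t) ≥ ε}` of a trajectory `x` with respect to a distance
function `D`, as an extended real number (the infimum of the empty set is `+∞`). -/
def exitTime {X : Type*} (D : X → X → ℝ) (x : ℝ → X) (ε : ℝ) : EReal :=
  sInf ((fun t : ℝ => (t : EReal)) '' {t : ℝ | 0 < t ∧ ε ≤ D (x 0) (x t)})

/-- The recurrence time `inf {t > exitTime | D (x 0) (x t) ≤ ε}`, as an extended real number. -/
def recTime {X : Type*} (D : X → X → ℝ) (x : ℝ → X) (ε : ℝ) : EReal :=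
  sInf ((fun t : ℝ => (t : EReal)) '' {t : ℝ | exitTime D x ε < (t : EReal) ∧ D (x 0) (x t) ≤ ε})

/-- The trace norm `‖A‖₁ = tr √(Aᴴ A)`, that is, the sum of the singular values of `A`. -/
def traceNorm {n : Type*} [Fintype n] [DecidableEq n] (A : Matrix n n ℂ) : ℝ :=
  ∑ i, Real.sqrt ((Matrix.isHermitian_conjTranspose_mul_self A).eigenvalues i)

/-- The trace distance `½ ‖ρ - σ‖₁`. -/
def traceDist {n : Type*} [Fintype n] [DecidableEq n] (ρ σ : Matrix n n ℂ) : ℝ :=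
  (1 / 2) * traceNorm (ρ - σ)

/-- The rank-one operator `|ψ⟩⟨ψ|`. -/
def pureState {n : Type*} (ψ : n → ℂ) : Matrix n n ℂ :=
  Matrix.vecMulVec ψ (star ψ)

/-- The time-evolved operator `e^{-iHt} ρ e^{iHt}`. -/
def evolve {n : Type*} [Fintype n] [DecidableEq n] (H ρ : Matrix n n ℂ) (t : ℝ) : Matrix n n ℂ :=
  NormedSpace.exp ((-(Complex.I * (t : ℂ))) • H) * ρ * NormedSpace.exp ((Complex.I * (t : ℂ)) • H)

/-- The diagonal Hamiltonian with real eigenvalues `l k`, whose eigenstates are the standard basis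
vectors. -/
def diagHamiltonian {n : Type*} [DecidableEq n] (l : n → ℝ) : Matrix n n ℂ :=
  Matrix.diagonal fun k => (l k : ℂ)

/-- The vector `∑ k, (1/√d) |k⟩`. -/
def uniformSuperposition (d : ℕ) : Fin d → ℂ :=
  fun _ => ((1 / Real.sqrt (d : ℝ) : ℝ) : ℂ)

/-- The recurrence time, in trace distance, of the evolution under the diagonal Hamiltonian with
eigenvalues `l`, started at the uniform superposition of its eigenstates. -/
def uniformRecTime {d : ℕ} (l : Fin d → ℝ) (ε : ℝ) : EReal :=
  recTime traceDist (evolve (diagHamiltonian l) (pureState (uniformSuperposition d))) ε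

end

end QRec

/-! The trace distance to the initial state is the square root of the infidelity 1 - |(1/d) ∑
e^{-iλ_k t}|². Up to time 3/2 all phase differences stay below π, so the infidelity increases and an
early return is impossible (`infidelity_lt_infidelity`, `lt_uniformRecTime`).

After time 3/2, a return forces the phases λ_k t to cluster around a common φ. For fixed t and φ,
independence and a Chernoff bound give this probability at most (20ε)^d (`prob_sum_one_sub_cos_le`).
Rounding t and φ to a mesh of order ε (`exists_grid_sum_le`) leaves a union bound over O(T'/ε) ·
O(1/ε) points; for T' = 40 (1/(10000ε))^d the lower bound on ε absorbs the factor ε⁻²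
(`grid_card_mul_le`). -/

namespace QRec

open Matrix Real
open scoped ComplexOrder

/-! ### Trace distance as infidelity -/

/-- A Hermitian matrix with `A³ = f A` and `tr A² = 2 f` has trace norm `2 √f`. -/
theorem traceNorm_eq_of_cube {n : Type*} [Fintype n] [DecidableEq n] {A : Matrix n n ℂ} {f : ℝ}
    (hA : A.IsHermitian) (hcube : A * A * A = (f : ℂ) • A) (htr : (A * A).trace = 2 * (f : ℂ)) :
    traceNorm A = 2 * √f := by
  unfold traceNorm
  set hB := Matrix.isHermitian_conjTranspose_mul_self A
  have hBsq : (Aᴴ * A) * (Aᴴ * A) = (f : ℂ) • (Aᴴ * A) := by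
    rw [hA.eq, ← mul_assoc, hcube, smul_mul_assoc]
  have hnonneg : ∀ i, 0 ≤ hB.eigenvalues i :=
    (Matrix.posSemidef_conjTranspose_mul_self A).eigenvalues_nonneg
  have heig : ∀ i, hB.eigenvalues i * hB.eigenvalues i = f * hB.eigenvalues i := by
    intro i
    have h1 := hB.mulVec_eigenvectorBasis i
    have hne : (hB.eigenvectorBasis i).ofLp ≠ 0 := by
      intro h
      exact hB.eigenvectorBasis.orthonormal.ne_zero i (by ext j; simpa using congrFun h j)
    have h2 := congrArg (fun M => M *ᵥ (hB.eigenvectorBasis i).ofLp) hBsq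
    simp only [← Matrix.mulVec_mulVec, Matrix.smul_mulVec, h1, Matrix.mulVec_smul] at h2
    obtain ⟨j, hj⟩ := Function.ne_iff.mp hne
    have h3 := congrFun h2 j
    simp only [Pi.smul_apply, Complex.real_smul, smul_eq_mul, ← mul_assoc] at h3
    have h4 := mul_right_cancel₀ hj h3
    exact_mod_cast h4
  have hsum : ∑ i, hB.eigenvalues i = 2 * f := by
    have h := hB.trace_eq_sum_eigenvalues
    have h' : (Aᴴ * A).trace = 2 * (f : ℂ) := by rw [hA.eq, htr]
    rw [h'] at h
    exact Complex.ofReal_injective (by push_cast; exact h.symm)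
  have hf : 0 ≤ f := by
    have := Finset.sum_nonneg fun i (_ : i ∈ Finset.univ) => hnonneg i
    linarith
  rcases hf.eq_or_lt with rfl | hf
  · simp only [zero_mul, mul_self_eq_zero] at heig
    simp [heig]
  · have hs : 0 < √f := Real.sqrt_pos.mpr hf
    -- Each eigenvalue is 0 or f, so the sum of roots reduces to the trace.
    have hi : ∀ i, √(hB.eigenvalues i) * √f = hB.eigenvalues i := by
      intro i
      rw [← Real.sqrt_mul (hnonneg i), mul_comm, ← heig, Real.sqrt_mul_self (hnonneg i)]
    have : (∑ i, √(hB.eigenvalues i)) * √f = (2 * √f) * √f := by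
      rw [Finset.sum_mul, Finset.sum_congr rfl fun i _ => hi i, hsum, mul_assoc,
        Real.mul_self_sqrt hf.le]
    exact mul_right_cancel₀ hs.ne' this

/-- The trace distance between two pure states is `√(1 - |⟨ψ|φ⟩|²)`. -/
theorem traceDist_pureState {n : Type*} [Fintype n] [DecidableEq n] {ψ φ : n → ℂ}
    (hψ : star ψ ⬝ᵥ ψ = 1) (hφ : star φ ⬝ᵥ φ = 1) :
    traceDist (pureState ψ) (pureState φ) = √(1 - ‖star ψ ⬝ᵥ φ‖ ^ 2) := by
  set c := star ψ ⬝ᵥ φ with hc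
  have hc' : star φ ⬝ᵥ ψ = star c := by
    rw [hc, Matrix.star_dotProduct]
  have hcc : c * star c = ((‖c‖ ^ 2 : ℝ) : ℂ) := by
    rw [Complex.star_def, Complex.mul_conj']; push_cast; rfl
  have hP : pureState ψ * pureState ψ = pureState ψ := by
    simp [pureState, Matrix.vecMulVec_mul_vecMulVec, hψ]
  have hQ : pureState φ * pureState φ = pureState φ := by
    simp [pureState, Matrix.vecMulVec_mul_vecMulVec, hφ]
  have hPQP : pureState ψ * pureState φ * pureState ψ = (c * star c) • pureState ψ := by
    simp only [pureState, Matrix.vecMulVec_mul_vecMulVec, ← hc, hc', Matrix.smul_mul,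
      Matrix.vecMulVec_smul, smul_smul]
  have hQPQ : pureState φ * pureState ψ * pureState φ = (c * star c) • pureState φ := by
    simp only [pureState, Matrix.vecMulVec_mul_vecMulVec, ← hc, hc', Matrix.smul_mul,
      Matrix.vecMulVec_smul, smul_smul, mul_comm]
  have htP : (pureState ψ).trace = 1 := by
    rw [pureState, Matrix.trace_vecMulVec, dotProduct_comm, hψ]
  have htQ : (pureState φ).trace = 1 := by
    rw [pureState, Matrix.trace_vecMulVec, dotProduct_comm, hφ]
  have htPQ : (pureState ψ * pureState φ).trace = c * star c := by
    rw [pureState, pureState, Matrix.vecMulVec_mul_vecMulVec, ← hc, Matrix.vecMulVec_smul,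
      Matrix.trace_smul, Matrix.trace_vecMulVec, dotProduct_comm, hc', smul_eq_mul]
  have hherm : ∀ χ : n → ℂ, (pureState χ).IsHermitian := fun χ =>
    (Matrix.posSemidef_vecMulVec_self_star χ).isHermitian
  have hsq : (pureState ψ - pureState φ) * (pureState ψ - pureState φ) =
      pureState ψ + pureState φ - pureState ψ * pureState φ - pureState φ * pureState ψ := by
    rw [sub_mul, mul_sub, mul_sub, hP, hQ]; abel
  have key := traceNorm_eq_of_cube (A := pureState ψ - pureState φ) (f := 1 - ‖c‖ ^ 2)
    ((hherm ψ).sub (hherm φ)) ?_ ?_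
  · rw [traceDist, key]; ring
  · have e : (((1 - ‖c‖ ^ 2 : ℝ)) : ℂ) = 1 - c * star c := by rw [hcc]; push_cast; rfl
    rw [hsq, e, sub_smul, one_smul, smul_sub, ← hPQP, ← hQPQ]
    simp only [mul_sub, sub_mul, add_mul]
    rw [mul_assoc (pureState ψ) (pureState φ) (pureState φ), hQ,
      mul_assoc (pureState φ) (pureState ψ) (pureState ψ), hP]
    abel
  · rw [hsq, Matrix.trace_sub, Matrix.trace_sub, Matrix.trace_add, htP, htQ,
      Matrix.trace_mul_comm (pureState φ), htPQ, hcc]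
    push_cast; ring

theorem evolve_zero {n : Type*} [Fintype n] [DecidableEq n] (H ρ : Matrix n n ℂ) :
    evolve H ρ 0 = ρ := by
  simp [evolve]

theorem evolve_diagHamiltonian_pureState {n : Type*} [Fintype n] [DecidableEq n] (l : n → ℝ)
    (ψ : n → ℂ) (t : ℝ) :
    evolve (diagHamiltonian l) (pureState ψ) t =
      pureState fun k => Complex.exp (-(Complex.I * t) * l k) * ψ k := by
  unfold evolve diagHamiltonian pureState
  rw [← Matrix.diagonal_smul, ← Matrix.diagonal_smul, Matrix.exp_diagonal, Matrix.exp_diagonal]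
  ext j k
  rw [Matrix.mul_diagonal, Matrix.diagonal_mul, Matrix.vecMulVec_apply, Matrix.vecMulVec_apply]
  simp only [Pi.coe_exp, Pi.star_apply, Pi.smul_apply, smul_eq_mul, star_mul', Complex.star_def,
    ← Complex.exp_conj, ← Complex.exp_eq_exp_ℂ, map_mul, map_neg, Complex.conj_I,
    Complex.conj_ofReal]
  ring_nf

/-- `1 - |(1/d) ∑ₖ exp (-i lₖ t)|²`, in real coordinates. -/
noncomputable def infidelity {d : ℕ} (l : Fin d → ℝ) (t : ℝ) : ℝ :=
  1 - ((∑ k, cos (l k * t)) ^ 2 + (∑ k, sin (l k * t)) ^ 2) / (d : ℝ) ^ 2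

theorem star_uniformSuperposition_dotProduct_phase {d : ℕ} (x : Fin d → ℂ) :
    star (uniformSuperposition d) ⬝ᵥ (fun k => x k * uniformSuperposition d k) =
      (∑ k, x k) / d := by
  have h : ((1 / √(d : ℝ) : ℝ) : ℂ) * ((1 / √(d : ℝ) : ℝ) : ℂ) = 1 / d := by
    rw [← Complex.ofReal_mul, div_mul_div_comm, Real.mul_self_sqrt (Nat.cast_nonneg d)]
    push_cast; ring
  simp only [dotProduct, uniformSuperposition, Pi.star_apply, Complex.star_def,
    Complex.conj_ofReal]
  rw [Finset.sum_div]
  refine Finset.sum_congr rfl fun k _ => ?_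
  rw [mul_left_comm, h]; ring

theorem traceDist_evolve_uniform {d : ℕ} (hd : d ≠ 0) (l : Fin d → ℝ) (t : ℝ) :
    traceDist (evolve (diagHamiltonian l) (pureState (uniformSuperposition d)) 0)
      (evolve (diagHamiltonian l) (pureState (uniformSuperposition d)) t) =
      √(infidelity l t) := by
  have hdc : (d : ℂ) ≠ 0 := by exact_mod_cast hd
  have hdr : (d : ℝ) ≠ 0 := by exact_mod_cast hd
  have h0 : star (uniformSuperposition d) ⬝ᵥ uniformSuperposition d = 1 := by
    have := star_uniformSuperposition_dotProduct_phase (d := d) 1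
    simpa [hdc] using this
  rw [evolve_zero, evolve_diagHamiltonian_pureState, traceDist_pureState h0,
    star_uniformSuperposition_dotProduct_phase, infidelity]
  · congr 2
    rw [norm_div, div_pow, Complex.norm_natCast, Complex.sq_norm, Complex.normSq_apply,
      Complex.re_sum, Complex.im_sum, pow_two, pow_two (∑ k, sin (l k * t))]
    have hre : ∀ k, (Complex.exp (-(Complex.I * t) * l k)).re = cos (l k * t) := by
      intro k; rw [Complex.exp_re]; simp [mul_comm]
    have him : ∀ k, (Complex.exp (-(Complex.I * t) * l k)).im = -sin (l k * t) := by
      intro k; rw [Complex.exp_im]; simp [mul_comm]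
    simp only [hre, him, Finset.sum_neg_distrib]
    ring
  · rw [← h0]
    refine Finset.sum_congr rfl fun k _ => ?_
    simp only [Pi.star_apply, star_mul', Complex.star_def, ← Complex.exp_conj, map_mul, map_neg,
      Complex.conj_I, Complex.conj_ofReal]
    rw [mul_mul_mul_comm, ← Complex.exp_add]
    simp
end QRec
-- Early monotonicity and discretisation
namespace QRec

open Real

theorem infidelity_eq_sum_sum {d : ℕ} (hd : d ≠ 0) (l : Fin d → ℝ) (t : ℝ) :
    infidelity l t = (∑ j, ∑ k, (1 - cos ((l j - l k) * t))) / (d : ℝ) ^ 2 := by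
  have hdr : (d : ℝ) ^ 2 ≠ 0 := by positivity
  have h : ∑ j, ∑ k, cos ((l j - l k) * t) =
      (∑ k, cos (l k * t)) ^ 2 + (∑ k, sin (l k * t)) ^ 2 := by
    simp only [pow_two, Finset.sum_mul_sum, ← Finset.sum_add_distrib]
    refine Finset.sum_congr rfl fun j _ => Finset.sum_congr rfl fun k _ => ?_
    rw [sub_mul, cos_sub]
  simp only [Finset.sum_sub_distrib, h]
  rw [infidelity, eq_div_iff hdr, sub_mul, div_mul_cancel₀ _ hdr]
  simp [pow_two]

/-- Since |λ_j - λ_k| t ≤ 3 < π, every pair term 1 - cos is monotone. Positivity at 3/2 supplies a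
pair of distinct eigenvalues, whence strictness. -/
theorem infidelity_lt_infidelity {d : ℕ} {l : Fin d → ℝ} (hl : ∀ k, |l k| ≤ 1)
    (hpos : 0 < infidelity l (3 / 2)) (hd : d ≠ 0) {s t : ℝ} (hs : 0 ≤ s) (hst : s < t)
    (ht : t ≤ 3 / 2) : infidelity l s < infidelity l t := by
  rw [infidelity_eq_sum_sum hd] at hpos ⊢
  rw [infidelity_eq_sum_sum hd]
  have habs : ∀ j k, |l j - l k| ≤ 2 := fun j k =>
    (abs_sub _ _).trans (by linarith [hl j, hl k])
  have hpi := Real.pi_gt_three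
  have habscos : ∀ j k (u : ℝ), cos ((l j - l k) * u) = cos (|l j - l k| * u) := by
    intro j k u
    rcases abs_choice (l j - l k) with h | h <;> rw [h]
    rw [neg_mul, cos_neg]
  have hbd : ∀ j k, |l j - l k| * t ≤ π := fun j k => by
    nlinarith [habs j k, abs_nonneg (l j - l k)]
  have hle : ∀ j k, 1 - cos ((l j - l k) * s) ≤ 1 - cos ((l j - l k) * t) := by
    intro j k
    rw [habscos, habscos]
    have := cos_le_cos_of_nonneg_of_le_pi (mul_nonneg (abs_nonneg (l j - l k)) hs) (hbd j k)
      (mul_le_mul_of_nonneg_left hst.le (abs_nonneg _))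
    linarith
  have hne : ∃ j k, l j ≠ l k := by
    by_contra! h
    simp [fun j k => sub_eq_zero.mpr (h j k)] at hpos
  obtain ⟨j, k, hjk⟩ := hne
  have hlt : 1 - cos ((l j - l k) * s) < 1 - cos ((l j - l k) * t) := by
    rw [habscos, habscos]
    have h0 : 0 < |l j - l k| := abs_pos.mpr (sub_ne_zero.mpr hjk)
    have := cos_lt_cos_of_nonneg_of_le_pi (mul_nonneg h0.le hs) (hbd j k)
      (mul_lt_mul_of_pos_left hst h0)
    linarith
  refine div_lt_div_of_pos_right ?_ (by positivity)
  refine Finset.sum_lt_sum (fun j _ => Finset.sum_le_sum fun k _ => hle j k)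
    ⟨j, Finset.mem_univ _, ?_⟩
  exact Finset.sum_lt_sum (fun k _ => hle j k) ⟨k, Finset.mem_univ _, hlt⟩

/-- If the trajectory stays away from its starting point during `[3/2, T']`, then it does not
recur before `T'`. -/
theorem lt_uniformRecTime {d : ℕ} (hd : d ≠ 0) {l : Fin d → ℝ} (hl : ∀ k, |l k| ≤ 1) {ε T T' : ℝ}
    (hε : 0 < ε) (hT : T < T') (hT' : 3 / 2 < T')
    (h : ∀ t, 3 / 2 ≤ t → t < T' → ε ^ 2 < infidelity l t) :
    (T : EReal) < uniformRecTime l ε := by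
  refine lt_of_lt_of_le (EReal.coe_lt_coe_iff.mpr hT) ?_
  refine le_sInf ?_
  rintro _ ⟨t, ⟨hexit, hrec⟩, rfl⟩
  refine EReal.coe_le_coe_iff.mpr ?_
  by_contra! htT
  rw [traceDist_evolve_uniform hd, Real.sqrt_le_left hε.le] at hrec
  obtain ⟨_, ⟨s, ⟨hs0, hs⟩, rfl⟩, hst⟩ := sInf_lt_iff.mp hexit
  replace hst : s < t := EReal.coe_lt_coe_iff.mp hst
  rw [traceDist_evolve_uniform hd, Real.le_sqrt' hε] at hs
  have ht : t ≤ 3 / 2 := by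
    by_contra! ht
    exact (h t ht.le htT).not_ge hrec
  have hpos : 0 < infidelity l (3 / 2) := (by positivity : 0 < ε ^ 2).trans (h _ le_rfl hT')
  linarith [infidelity_lt_infidelity hl hpos hd hs0.le hst ht]

/-- Take φ = arg z with z = ∑ e^{iλ_k t}: the sum equals d - |z|, and 1 - x ≤ 1 - x² for x = |z|/d ∈
[0,1]. -/
theorem exists_phase_sum_le {d : ℕ} (hd : d ≠ 0) (l : Fin d → ℝ) (t : ℝ) :
    ∃ φ ∈ Set.Ioc (-π) π, ∑ k, (1 - cos (l k * t - φ)) ≤ d * infidelity l t := by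
  set z : ℂ := ⟨∑ k, cos (l k * t), ∑ k, sin (l k * t)⟩ with hz
  refine ⟨z.arg, z.arg_mem_Ioc, ?_⟩
  have hd0 : (0 : ℝ) < d := by positivity
  have hre : ‖z‖ * cos z.arg = ∑ k, cos (l k * t) := Complex.norm_mul_cos_arg z
  have him : ‖z‖ * sin z.arg = ∑ k, sin (l k * t) := Complex.norm_mul_sin_arg z
  have hsum : ∑ k, cos (l k * t - z.arg) = ‖z‖ := by
    simp only [cos_sub, Finset.sum_add_distrib, ← Finset.sum_mul, ← hre, ← him]
    linear_combination ‖z‖ * Real.sin_sq_add_cos_sq z.arg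
  have hinf : infidelity l t = 1 - ‖z‖ ^ 2 / (d : ℝ) ^ 2 := by
    rw [infidelity, ← hre, ← him]
    linear_combination -‖z‖ ^ 2 / (d : ℝ) ^ 2 * Real.sin_sq_add_cos_sq z.arg
  have hle : ‖z‖ ≤ d := by
    rw [← hsum]
    exact (Finset.sum_le_sum fun k _ => cos_le_one _).trans (by simp)
  rw [Finset.sum_sub_distrib, hsum, hinf]
  simp only [Finset.sum_const, Finset.card_univ, Fintype.card_fin, nsmul_eq_mul, mul_one]
  have e : (d : ℝ) * (1 - ‖z‖ ^ 2 / (d : ℝ) ^ 2) = d - ‖z‖ * (‖z‖ / d) := by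
    field_simp
  rw [e]
  have : ‖z‖ / d ≤ 1 := (div_le_one hd0).mpr hle
  nlinarith [norm_nonneg z]

/-- Since 2(1 - cos a) = |e^{ia} - 1|², this is |x + y|² ≤ 2|x|² + 2|y|² combined with 2(1 - cos b)
≤ b². -/
theorem one_sub_cos_add_le (a b : ℝ) : 1 - cos (a + b) ≤ 2 * (1 - cos a) + b ^ 2 := by
  have hb := one_sub_sq_div_two_le_cos (x := b)
  rw [cos_add]
  have ha := sin_sq_add_cos_sq a
  have hb' := sin_sq_add_cos_sq b
  nlinarith [sq_nonneg (cos a + cos b - 2), sq_nonneg (sin a - sin b)]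

/-- A small infidelity at time `t` is witnessed on a grid of times and phases of mesh `ε / 2`. -/
theorem exists_grid_sum_le {d : ℕ} (hd : d ≠ 0) {l : Fin d → ℝ} (hl : ∀ k, |l k| ≤ 1)
    {ε t T' : ℝ} (hε : 0 < ε) (ht : 3 / 2 ≤ t) (htT : t < T') (h : infidelity l t ≤ ε ^ 2) :
    ∃ m ∈ Finset.range (⌊2 * T' / ε⌋₊ + 1), ∃ n ∈ Finset.range (⌊4 * π / ε⌋₊ + 1),
      ∑ k, (1 - cos (l k * (3 / 2 + m * (ε / 2)) - (-π + n * (ε / 2)))) ≤ 3 * d * ε ^ 2 := by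
  obtain ⟨φ, ⟨hφ1, hφ2⟩, hφ⟩ := exists_phase_sum_le hd l t
  have hgrid : ∀ x : ℝ, 0 ≤ x → |x - ⌊x / (ε / 2)⌋₊ * (ε / 2)| ≤ ε / 2 := by
    intro x hx
    have h2 : 0 < ε / 2 := by positivity
    have h1 := Nat.floor_le (div_nonneg hx h2.le)
    have h3 := (Nat.lt_floor_add_one (x / (ε / 2))).le
    rw [le_div_iff₀ h2] at h1
    rw [div_le_iff₀ h2] at h3
    rw [abs_le]
    constructor <;> linarith
  have hmono : ∀ x c : ℝ, x ≤ c → ⌊x / (ε / 2)⌋₊ ∈ Finset.range (⌊2 * c / ε⌋₊ + 1) := by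
    intro x c hx
    rw [Finset.mem_range, Nat.lt_succ_iff]
    refine Nat.floor_le_floor ?_
    have : 2 * c / ε = c / (ε / 2) := by field_simp
    rw [this]
    gcongr
  refine ⟨⌊(t - 3 / 2) / (ε / 2)⌋₊, hmono _ T' (by linarith), ⌊(φ + π) / (ε / 2)⌋₊, ?_, ?_⟩
  · have := hmono (φ + π) (2 * π) (by linarith)
    rwa [← mul_assoc, show (2 : ℝ) * 2 = 4 by norm_num] at this
  have hm := hgrid (t - 3 / 2) (by linarith)
  have hn := hgrid (φ + π) (by linarith)
  generalize ((⌊(t - 3 / 2) / (ε / 2)⌋₊ : ℕ) : ℝ) = m at hm ⊢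
  generalize ((⌊(φ + π) / (ε / 2)⌋₊ : ℕ) : ℝ) = n at hn ⊢
  have hk : ∀ k, 1 - cos (l k * (3 / 2 + m * (ε / 2)) - (-π + n * (ε / 2))) ≤
      2 * (1 - cos (l k * t - φ)) + ε ^ 2 := by
    intro k
    -- The total rounding error of the phase: ε/2 from time (using |λ_k| ≤ 1) and ε/2 from φ.
    set b := -(l k * (t - 3 / 2 - m * (ε / 2))) + (φ + π - n * (ε / 2)) with hb
    have hb' : |b| ≤ ε := by
      refine (abs_add_le _ _).trans ?_
      rw [abs_neg, abs_mul]
      nlinarith [hl k, abs_nonneg (l k), abs_nonneg (t - 3 / 2 - m * (ε / 2))]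
    have := one_sub_cos_add_le (l k * t - φ) b
    rw [show l k * t - φ + b = l k * (3 / 2 + m * (ε / 2)) - (-π + n * (ε / 2)) by
      rw [hb]; ring] at this
    have hb2 : b ^ 2 ≤ ε ^ 2 := sq_le_sq' (abs_le.mp hb').1 (abs_le.mp hb').2
    linarith
  refine (Finset.sum_le_sum fun k _ => hk k).trans ?_
  rw [Finset.sum_add_distrib, ← Finset.mul_sum]
  simp only [Finset.sum_const, Finset.card_univ, Fintype.card_fin, nsmul_eq_mul]
  nlinarith [mul_le_mul_of_nonneg_left h (Nat.cast_nonneg (α := ℝ) d)]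

end QRec
-- Chernoff bound at a fixed time and phase
namespace QRec

open Real MeasureTheory ProbabilityTheory

/-- On [-π, π], 1 - cos u ≥ 2u²/π², so a Gaussian dominates. -/
theorem integral_exp_neg_one_sub_cos_le {s : ℝ} (hs : 0 < s) :
    ∫ u in (-π)..π, exp (-s * (1 - cos u)) ≤ √(π ^ 3 / (2 * s)) := by
  have hpi := Real.pi_pos
  have hb : 0 < 2 * s / π ^ 2 := by positivity
  have hint := integrable_exp_neg_mul_sq hb
  calc ∫ u in (-π)..π, exp (-s * (1 - cos u))
      ≤ ∫ u in (-π)..π, exp (-(2 * s / π ^ 2) * u ^ 2) := by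
        refine intervalIntegral.integral_mono_on (by linarith)
          (Continuous.intervalIntegrable (by fun_prop) _ _) hint.intervalIntegrable fun u hu => ?_
        refine exp_le_exp.mpr ?_
        have h := cos_le_one_sub_mul_cos_sq (abs_le.mpr hu)
        have h' := mul_le_mul_of_nonneg_left h hs.le
        have e : -(2 * s / π ^ 2) * u ^ 2 = -(s * (2 / π ^ 2 * u ^ 2)) := by ring
        rw [e]
        linarith
    _ ≤ ∫ u, exp (-(2 * s / π ^ 2) * u ^ 2) := by
        rw [intervalIntegral.integral_of_le (by linarith)]
        exact setIntegral_le_integral hint (Filter.Eventually.of_forall fun _ => (exp_pos _).le)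
    _ = √(π ^ 3 / (2 * s)) := by
        rw [integral_gaussian]
        congr 1
        field_simp

/-- A window of length `2 t ≥ 3` is covered by at most `2 t` periods of length `2 π`. -/
theorem integral_window_le_of_periodic {g : ℝ → ℝ} (hg : Continuous g) (hg0 : ∀ u, 0 ≤ g u)
    (hper : Function.Periodic g (2 * π)) {t : ℝ} (ht : 3 / 2 ≤ t) (a : ℝ) :
    ∫ u in a..(a + 2 * t), g u ≤ 2 * t * ∫ u in (-π)..π, g u := by
  have hpi := Real.pi_gt_three
  have hint : ∀ x y, IntervalIntegrable g volume x y := fun x y => hg.intervalIntegrable x y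
  have hI : 0 ≤ ∫ u in (-π)..π, g u :=
    intervalIntegral.integral_nonneg (by linarith) fun u _ => hg0 u
  set N : ℕ := ⌈t / π⌉₊ with hN
  have hN1 : t / π ≤ N := Nat.le_ceil _
  have hN2 : (N : ℝ) ≤ 2 * t := by
    have h1 : (N : ℝ) < t / π + 1 := Nat.ceil_lt_add_one (by positivity)
    have h2 : t / π ≤ t / 3 := div_le_div_of_nonneg_left (by linarith) (by norm_num) hpi.le
    linarith
  rw [div_le_iff₀ (by linarith)] at hN1
  have hwin := hper.intervalIntegral_add_zsmul_eq N a hint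
  rw [hper.intervalIntegral_add_eq a (-π), show -π + 2 * π = π by ring] at hwin
  simp only [zsmul_eq_mul, Int.cast_natCast] at hwin
  calc ∫ u in a..(a + 2 * t), g u ≤ ∫ u in a..(a + N * (2 * π)), g u :=
        intervalIntegral.integral_mono_interval le_rfl (by linarith) (by linarith)
          (Filter.Eventually.of_forall hg0) (hint _ _)
    _ = N * ∫ u in (-π)..π, g u := hwin
    _ ≤ _ := mul_le_mul_of_nonneg_right hN2 hI

variable {Ω : Type*} [MeasurableSpace Ω] {P : Measure Ω}

theorem aemeasurable_of_isUniform_Icc {X : Ω → ℝ}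
    (hX : pdf.IsUniform X (Set.Icc (-1 : ℝ) 1) P) : AEMeasurable X P :=
  hX.aemeasurable (by simp) (by simp)

theorem integral_comp_of_isUniform_Icc {X : Ω → ℝ}
    (hX : pdf.IsUniform X (Set.Icc (-1 : ℝ) 1) P) {g : ℝ → ℝ} (hg : Continuous g) :
    ∫ ω, g (X ω) ∂P = (1 / 2) * ∫ x in (-1 : ℝ)..1, g x := by
  have hm : Measure.map X P = ProbabilityTheory.cond volume (Set.Icc (-1 : ℝ) 1) := hX
  rw [← integral_map (aemeasurable_of_isUniform_Icc hX) hg.aestronglyMeasurable, hm,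
    ProbabilityTheory.cond, integral_smul_measure, intervalIntegral.integral_of_le (by norm_num),
    integral_Icc_eq_integral_Ioc]
  norm_num

/-- Substituting u = tx - φ, the density 1/2 and Jacobian 1/t cancel the 2t periods of the window,
so the bound is uniform in t and φ. -/
theorem mgf_one_sub_cos_le {X : Ω → ℝ} (hX : pdf.IsUniform X (Set.Icc (-1 : ℝ) 1) P)
    {s t : ℝ} (hs : 0 < s) (ht : 3 / 2 ≤ t) (φ : ℝ) :
    mgf (fun ω => 1 - cos (X ω * t - φ)) P (-s) ≤ √(π ^ 3 / (2 * s)) := by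
  set g : ℝ → ℝ := fun u => exp (-s * (1 - cos u)) with hg
  have hgc : Continuous g := by fun_prop
  have hper : Function.Periodic g (2 * π) := fun u => by simp only [hg, cos_add_two_pi]
  have ht0 : t ≠ 0 := by linarith
  have h1 : mgf (fun ω => 1 - cos (X ω * t - φ)) P (-s) =
      (1 / 2) * ∫ x in (-1 : ℝ)..1, g (t * x - φ) := by
    rw [← integral_comp_of_isUniform_Icc hX (g := fun x => g (t * x - φ)) (by fun_prop)]
    simp only [mgf, hg, mul_comm t]
  have hwin := integral_window_le_of_periodic hgc (fun u => (exp_pos _).le) hper ht (t * -1 - φ)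
  rw [show t * -1 - φ + 2 * t = t * 1 - φ by ring] at hwin
  rw [h1, intervalIntegral.integral_comp_mul_sub _ ht0, smul_eq_mul]
  have h0 : ∫ u in (-π)..π, g u ≤ √(π ^ 3 / (2 * s)) := integral_exp_neg_one_sub_cos_le hs
  refine le_trans ?_ h0
  have h2 := mul_le_mul_of_nonneg_left hwin (show 0 ≤ 1 / 2 * t⁻¹ by positivity)
  calc _ = 1 / 2 * t⁻¹ * ∫ x in (t * -1 - φ)..(t * 1 - φ), g x := by ring
    _ ≤ _ := h2
    _ = _ := by field_simp

theorem prob_sum_one_sub_cos_le [IsProbabilityMeasure P] {d : ℕ} {eig : Fin d → Ω → ℝ}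
    (hindep : iIndepFun eig P) (hunif : ∀ k, pdf.IsUniform (eig k) (Set.Icc (-1 : ℝ) 1) P)
    {ε t : ℝ} (hε : 0 < ε) (ht : 3 / 2 ≤ t) (φ : ℝ) :
    P.real {ω | ∑ k, (1 - cos (eig k ω * t - φ)) ≤ 3 * d * ε ^ 2} ≤ (20 * ε) ^ d := by
  set X : Fin d → Ω → ℝ := fun k ω => 1 - cos (eig k ω * t - φ) with hX
  have hmeas : ∀ k, AEMeasurable (X k) P := fun k =>
    (show Measurable fun x : ℝ => 1 - cos (x * t - φ) by fun_prop).comp_aemeasurable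
      (aemeasurable_of_isUniform_Icc (hunif k))
  have hXind : iIndepFun X P :=
    hindep.comp (fun _ x => 1 - cos (x * t - φ)) fun _ => by fun_prop
  -- This choice makes the Chernoff prefactor e^d; each factor is at most √(3π³/2) ε ≤ 7ε, and 7e <
  -- 20.
  set s : ℝ := 1 / (3 * ε ^ 2) with hs
  have hs0 : 0 < s := by positivity
  have hsum : AEMeasurable (∑ k, X k) P := Finset.aemeasurable_sum _ fun k _ => hmeas k
  have hint : Integrable (fun ω => exp (-s * (∑ k, X k) ω)) P := by
    refine Integrable.of_bound (C := 1) (by fun_prop) (Filter.Eventually.of_forall fun ω => ?_)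
    rw [Real.norm_eq_abs, abs_exp, exp_le_one_iff, Finset.sum_apply]
    have : 0 ≤ ∑ k, X k ω := Finset.sum_nonneg fun k _ => by
      simp only [hX]; linarith [cos_le_one (eig k ω * t - φ)]
    nlinarith
  have hch := measure_le_le_exp_mul_mgf (3 * d * ε ^ 2) (neg_nonpos.mpr hs0.le) hint
  simp only [Finset.sum_apply] at hch
  refine hch.trans ?_
  rw [hXind.mgf_sum₀ hmeas]
  have hexp : exp (-(-s) * (3 * d * ε ^ 2)) = exp 1 ^ d := by
    rw [← exp_nat_mul]
    congr 1
    rw [hs]; field_simp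
  have hpi := Real.pi_pos
  have hone : ∀ k, mgf (X k) P (-s) ≤ 7 * ε := by
    intro k
    refine (mgf_one_sub_cos_le (hunif k) hs0 ht φ).trans ?_
    refine Real.sqrt_le_iff.mpr ⟨by positivity, ?_⟩
    have e : π ^ 3 / (2 * s) = (3 / 2 * π ^ 3) * ε ^ 2 := by rw [hs]; field_simp
    have hpi3 : π ^ 3 ≤ 3.15 ^ 3 := by gcongr; exact Real.pi_lt_d2.le
    rw [e, mul_pow]
    gcongr
    linarith
  calc exp (-(-s) * (3 * d * ε ^ 2)) * ∏ k, mgf (X k) P (-s)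
      ≤ exp 1 ^ d * (7 * ε) ^ d := by
        rw [hexp]
        gcongr
        refine (Finset.prod_le_prod (fun k _ => mgf_nonneg) fun k _ => hone k).trans ?_
        simp
    _ = (exp 1 * (7 * ε)) ^ d := (mul_pow _ _ _).symm
    _ ≤ (20 * ε) ^ d := by
        have := Real.exp_one_lt_d9
        refine pow_le_pow_left₀ (by positivity) ?_ d
        nlinarith

end QRec
-- Union bound over the grid
namespace QRec

open Real MeasureTheory ProbabilityTheory

theorem half_pow_lt_of_rpow_lt {ε : ℝ} {d : ℕ} (h0 : 0 < ε) (h1 : ε ≤ 1)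
    (h : (40 * π) ^ (1 / 3 : ℝ) * (1 / 2 : ℝ) ^ ((d : ℝ) / 3) < ε) :
    40 * π * (1 / 2) ^ d < ε ^ 2 := by
  have hpi := Real.pi_pos
  have e : ((40 * π) ^ (1 / 3 : ℝ) * (1 / 2 : ℝ) ^ ((d : ℝ) / 3)) ^ 3 = 40 * π * (1 / 2) ^ d := by
    rw [mul_pow, ← rpow_natCast, ← rpow_mul (by positivity), ← rpow_natCast (_ ^ _),
      ← rpow_mul (by positivity), ← rpow_natCast _ d]
    norm_num
  rw [← e]
  refine (pow_lt_pow_left₀ h (by positivity) three_ne_zero).trans_le ?_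
  exact pow_le_pow_of_le_one h0.le h1 (by norm_num)

theorem grid_card_mul_le {ε : ℝ} {d : ℕ} (hd : d ≠ 0) (h0 : 0 < ε) (h1 : ε < 1 / 10000)
    (h : 40 * π * (1 / 2) ^ d < ε ^ 2) :
    ((⌊2 * (40 * (1 / 10000 * (1 / ε)) ^ d) / ε⌋₊ + 1 : ℕ) : ℝ) * ((⌊4 * π / ε⌋₊ + 1 : ℕ) : ℝ) *
      (20 * ε) ^ d ≤ (3 / 4) ^ d := by
  have hpi := Real.pi_gt_three
  have hpi' := Real.pi_lt_d2
  set r := 1 / 10000 * (1 / ε) with hr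
  have hr1 : 1 ≤ r := by
    rw [hr, div_mul_div_comm, le_div_iff₀ (by positivity)]
    linarith
  have hrd : 1 ≤ r ^ d := one_le_pow₀ hr1
  have hA : ((⌊2 * (40 * r ^ d) / ε⌋₊ + 1 : ℕ) : ℝ) ≤ 120 * r ^ d / ε := by
    have h2 := Nat.floor_le (show 0 ≤ 2 * (40 * r ^ d) / ε by positivity)
    have h3 : 1 ≤ 40 * r ^ d / ε := by
      rw [le_div_iff₀ h0]; linarith
    push_cast
    calc _ ≤ 2 * (40 * r ^ d) / ε + 40 * r ^ d / ε := add_le_add h2 h3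
      _ = _ := by ring
  have hB : ((⌊4 * π / ε⌋₊ + 1 : ℕ) : ℝ) ≤ 16 / ε := by
    have h2 := Nat.floor_le (show 0 ≤ 4 * π / ε by positivity)
    push_cast
    refine (add_le_add_left h2 1).trans ?_
    rw [div_add_one h0.ne']
    gcongr
    linarith
  have hinv : 1 / ε ^ 2 ≤ 2 ^ d / 120 := by
    rw [div_le_div_iff₀ (by positivity) (by norm_num)]
    have h2 : (1 / 2 : ℝ) ^ d * 2 ^ d = 1 := by rw [← mul_pow]; norm_num
    have h3 : (0 : ℝ) < (1 / 2) ^ d := by positivity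
    have h4 : (0 : ℝ) < 2 ^ d := by positivity
    have h5 : 120 * (1 / 2 : ℝ) ^ d ≤ ε ^ 2 := by nlinarith
    nlinarith
  -- 375/2 = 250 · 3/4 turns 16 · 250^{-d} into (3/4)^d.
  have hpow : (16 : ℝ) ≤ (375 / 2) ^ d :=
    (by norm_num : (16 : ℝ) ≤ 375 / 2).trans (le_self_pow₀ (by norm_num) hd)
  calc _ ≤ (120 * r ^ d / ε) * (16 / ε) * (20 * ε) ^ d := by gcongr
    _ = 1920 * (r * (20 * ε)) ^ d * (1 / ε ^ 2) := by rw [mul_pow r]; ring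
    _ = 1920 * (1 / 500) ^ d * (1 / ε ^ 2) := by
        congr 3
        rw [hr]; field_simp; norm_num
    _ ≤ 1920 * (1 / 500) ^ d * (2 ^ d / 120) := by gcongr
    _ = 16 * (1 / 250) ^ d := by
        rw [show (1 / 250 : ℝ) = 1 / 500 * 2 by norm_num, mul_pow]; ring
    _ ≤ (375 / 2) ^ d * (1 / 250) ^ d := by gcongr
    _ = (3 / 4) ^ d := by rw [← mul_pow]; norm_num

variable {Ω : Type*} [MeasurableSpace Ω] {P : Measure Ω}

theorem ae_abs_le_one_of_isUniform_Icc {X : Ω → ℝ}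
    (hX : pdf.IsUniform X (Set.Icc (-1 : ℝ) 1) P) : ∀ᵐ ω ∂P, |X ω| ≤ 1 := by
  have h : ∀ᵐ x ∂(Measure.map X P), x ∈ Set.Icc (-1 : ℝ) 1 := by
    rw [show Measure.map X P = _ from hX]
    exact ae_cond_mem measurableSet_Icc
  filter_upwards [ae_of_ae_map (aemeasurable_of_isUniform_Icc hX) h] with ω hω
  exact abs_le.mpr hω

/-- The implication also counts outcomes with some |λ_k| > 1 as bad; they form a null set. -/
theorem prob_infidelity_le [IsProbabilityMeasure P] {d : ℕ} (hd : d ≠ 0) {eig : Fin d → Ω → ℝ}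
    (hindep : iIndepFun eig P) (hunif : ∀ k, pdf.IsUniform (eig k) (Set.Icc (-1 : ℝ) 1) P)
    {ε : ℝ} (hε : 0 < ε) (T' : ℝ) :
    P.real {ω | (∀ k, |eig k ω| ≤ 1) →
        ∃ t, 3 / 2 ≤ t ∧ t < T' ∧ infidelity (fun k => eig k ω) t ≤ ε ^ 2} ≤
      ((⌊2 * T' / ε⌋₊ + 1 : ℕ) : ℝ) * ((⌊4 * π / ε⌋₊ + 1 : ℕ) : ℝ) * (20 * ε) ^ d := by
  set G := Finset.range (⌊2 * T' / ε⌋₊ + 1) ×ˢ Finset.range (⌊4 * π / ε⌋₊ + 1) with hG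
  set E : ℕ × ℕ → Set Ω := fun p => {ω | ∑ k, (1 - cos (eig k ω * (3 / 2 + p.1 * (ε / 2)) -
    (-π + p.2 * (ε / 2)))) ≤ 3 * d * ε ^ 2}
  have hnull : P.real {ω | ¬ ∀ k, |eig k ω| ≤ 1} = 0 := by
    rw [measureReal_def,
      ae_iff.mp (ae_all_iff.mpr fun k => ae_abs_le_one_of_isUniform_Icc (hunif k))]
    rfl
  refine (measureReal_mono (s₂ := (⋃ p ∈ G, E p) ∪ {ω | ¬ ∀ k, |eig k ω| ≤ 1}) ?_).trans ?_
  · intro ω hω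
    by_cases hl : ∀ k, |eig k ω| ≤ 1
    · obtain ⟨t, ht, htT, hf⟩ := hω hl
      obtain ⟨m, hm, n, hn, h⟩ := exists_grid_sum_le hd hl hε ht htT hf
      exact Or.inl (Set.mem_biUnion (show (m, n) ∈ G from Finset.mk_mem_product hm hn) h)
    · exact Or.inr hl
  · refine (measureReal_union_le _ _).trans ?_
    rw [hnull, add_zero]
    refine (measureReal_biUnion_finset_le G E).trans ?_
    refine (Finset.sum_le_card_nsmul G _ ((20 * ε) ^ d) fun p _ =>
      prob_sum_one_sub_cos_le hindep hunif hε ?_ _).trans ?_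
    · have : (0 : ℝ) ≤ p.1 * (ε / 2) := by positivity
      linarith
    · rw [hG, Finset.card_product, Finset.card_range, Finset.card_range, nsmul_eq_mul,
        Nat.cast_mul]

end QRec

open QRec in
theorem theoremS2 {Ω : Type*} [MeasurableSpace Ω] (P : MeasureTheory.Measure Ω)
    [MeasureTheory.IsProbabilityMeasure P] (d : ℕ) (eig : Fin d → Ω → ℝ)
    (hindep : ProbabilityTheory.iIndepFun eig P)
    (hunif : ∀ k, MeasureTheory.pdf.IsUniform (eig k) (Set.Icc (-1 : ℝ) 1) P)
    (ε : ℝ)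
    (hε_lower : (40 * Real.pi) ^ (1 / 3 : ℝ) * (1 / 2 : ℝ) ^ ((d : ℝ) / 3) < ε)
    (hε_upper : ε < 1 / 10000) :
    1 - (3 / 4 : ℝ) ^ d - 5 * Real.exp (-((d : ℝ) / 400)) ≤
      P.real {ω | ((20 * (1 / 10000 * (1 / ε)) ^ d : ℝ) : EReal) <
        QRec.uniformRecTime (fun k => eig k ω) ε} := by
  have hpi := Real.pi_gt_three
  have hε : 0 < ε := lt_of_le_of_lt (by positivity) hε_lower
  have hcube := half_pow_lt_of_rpow_lt hε (by linarith) hε_lower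
  have hd : d ≠ 0 := by
    rintro rfl
    nlinarith
  have hr : 1 ≤ (1 / 10000 * (1 / ε)) ^ d := by
    refine one_le_pow₀ ?_
    rw [div_mul_div_comm, le_div_iff₀ (by positivity)]
    linarith
  set S := {ω | ((20 * (1 / 10000 * (1 / ε)) ^ d : ℝ) : EReal) <
        QRec.uniformRecTime (fun k => eig k ω) ε}
  -- The horizon is 40 rather than 20 times the power: avoiding returns before T' only gives
  -- recurrence time ≥ T', and the conclusion is strict.
  have hbad := (prob_infidelity_le hd hindep hunif hε (40 * (1 / 10000 * (1 / ε)) ^ d)).trans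
    (grid_card_mul_le hd hε hε_upper hcube)
  have hcompl : P.real Sᶜ ≤ (3 / 4) ^ d := by
    refine (MeasureTheory.measureReal_mono fun ω hω hl => ?_).trans hbad
    by_contra! h
    exact hω (lt_uniformRecTime hd hl hε (by linarith) (by linarith) h)
  -- Subadditivity suffices, so S need not be measurable.
  have hone : 1 ≤ P.real S + P.real Sᶜ := by
    have := MeasureTheory.measureReal_union_le (μ := P) S Sᶜ
    rwa [Set.union_compl_self, MeasureTheory.probReal_univ] at this
  linarith [Real.exp_pos (-((d : ℝ) / 400))]
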